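/- Fix $m\in\mathbb N$. An ID-generation algorithm $\mathcal A$ is a probability distribution on the permutations of $[m]=\{1,\dots,m\}$; an instance of $\mathcal A$ draws a permutation and returns the IDs in that order. A non-trivial demand profile is a vector $D=(d_1,\dots,d_n)\in[m]^n$ with $n\ge 2$; $p_{\mathcal A}(D)$ denotes the probability that, when $n$ independent instances of $\mathcal A$ return $d_1,\dots,d_n$ IDs respectively, the sets of returned IDs are not pairwise disjoint (a collision), and $p_*(D)=\min_{\mathcal A'}p_{\mathcal A'}(D)$. For a set $\mathcal D$ of non-trivial demand profiles, the competitive ratio of $\mathcal A$ for $\mathcal D$ is $\sup_{D\in\mathcal D}p_{\mathcal A}(D)/p_*(D)$. An adaptive adversary $Z$ (possibly randomized) starts with the empty profile and, in each step, either activates a new independent instance of $\mathcal A$ and requests one ID from it (appending an entry $1$ to the profile), or requests one more ID from an already active instance (incrementing its entry), or stops; it sees every ID returned, and its decisions may depend on them. $\mathrm{Adv}(\mathcal D)$ is the set of adversaries that always stop eventually, with a final profile in $\mathcal D$. Let $p_{\mathcal A}(Z)$ be the probability that a collision has occurred when the game ends, and let $\mathbb E_{D\sim Z}[p_*(D)]$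 be the expectation of $p_*$ at the final profile of the game between $Z$ and $\mathcal A$. The competitive ratio of $\mathcal A$ for $\mathrm{Adv}(\mathcal D)$ is $\sup_{Z\in\mathrm{Adv}(\mathcal D)}p_{\mathcal A}(Z)/\mathbb E_{D\sim Z}[p_*(D)]$. For $k\in[m]$, $\mathrm{BINS}(k)$ divides $[m]$ into $\lfloor m/k\rfloor$ consecutive bins of $k$ IDs and $m\bmod k$ leftover IDs, goes through the bins in a uniformly random order, returning the IDs of each bin in increasing order, and finally returns the leftover IDs in increasing order. $\mathrm{BINS}^*$ (for $m\ge 2$) uses $C=\lceil\log_2 m-\log_2\log_2 m\rceil$ consecutive disjoint chunks of $2^{C-1}$ IDs each, the $i$th of which is divided into $2^{C-i}$ consecutive bins of $2^{i-1}$ IDs; for $i=1,\dots,C$ in turn it picks, independently, a uniformly random bin of the $i$th chunk and returns its IDs in increasing order. This specifies the first $2^C-1$ IDs; the order of the remaining ones may be completed in any way. **Theorem.** Let $\mathcal D$ be a set of non-trivial demand profiles, and let $\mathcal A$ be either $\mathrm{BINS}(k)$ for some $k\in[m]$, or $\mathrm{BINS}^*$, where in the latter case all entries of the profiles in $\mathcal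 D$ are at most $2^C-1$. If $\mathcal A$ has competitive ratio $c$ for $\mathcal D$, then $\mathcal A$ has competitive ratio at most $4c$ for $\mathrm{Adv}(\mathcal D)$. -/

import Mathlib

open scoped ENNReal

noncomputable section

namespace UUID

/-! ### Algorithms, demand profiles, collisions

IDs are the elements of `Fin m`.  An ID-generation algorithm is a probability distribution on
the permutations of the ID space; under the outcome `σ` the IDs are produced in the order
`σ 0, σ 1, …, σ (m - 1)`. -/

/-- An ID-generation algorithm over a universe of `m` IDs. -/
abbrev Algorithm (m : ℕ) := PMF (Equiv.Perm (Fin m))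

/-- A demand profile `(d₁, …, dₙ)`, for an arbitrary number `n` of instances. -/
abbrev Profile := Σ n : ℕ, (Fin n → ℕ)

/-- A non-trivial demand profile: `n ≥ 2` instances, with demands in `{1, …, m}`. -/
def Profile.Nontrivial (m : ℕ) (D : Profile) : Prop :=
  2 ≤ D.1 ∧ ∀ i, 1 ≤ D.2 i ∧ D.2 i ≤ m

/-- If instance `i` produces its IDs in the order `σ i` and is asked for `D i` of them, then the
sets of IDs produced by the instances are not pairwise disjoint. -/
def Collision {m n : ℕ} (σ : Fin n → Equiv.Perm (Fin m)) (D : Fin n → ℕ) : Prop :=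
  ∃ i j : Fin n, i ≠ j ∧ ∃ a b : Fin m, (a : ℕ) < D i ∧ (b : ℕ) < D j ∧ σ i a = σ j b

open Classical in
/-- The probability `p_A(D)` of a collision when `n` independent instances of `A` serve `D`. -/
def collisionProb {m : ℕ} (A : Algorithm m) (D : Profile) : ℝ≥0∞ :=
  ∑ σ : Fin D.1 → Equiv.Perm (Fin m), if Collision σ D.2 then ∏ i, A (σ i) else 0

/-- The best possible collision probability `p_*(D)`. -/
def optProb (m : ℕ) (D : Profile) : ℝ≥0∞ :=
  ⨅ A : Algorithm m, collisionProb A D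

/-- The competitive ratio of `A` for a set of demand profiles (oblivious adversaries). -/
def competitiveRatio {m : ℕ} (A : Algorithm m) (𝒟 : Set Profile) : ℝ≥0∞ :=
  ⨆ D ∈ 𝒟, collisionProb A D / optProb m D

/-! ### Adaptive adversaries -/

/-- `Adversary m D` is the type of (possibly randomized) strategies of an adaptive adversary from
the moment when the current demand profile is `D`.  The adversary stops, or activates a new
instance, or requests a further ID from an active instance; in the last two cases it learns the ID
that is produced, and continues depending on it.  It may also toss a (biased, many-sided) coin.
A strategy is a well-founded tree, so the game always ends. -/
inductive Adversary (m : ℕ) : {n : ℕ} → (Fin n → ℕ) → Type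
  | halt {n : ℕ} {D : Fin n → ℕ} : Adversary m D
  | activate {n : ℕ} {D : Fin n → ℕ} (hm : 0 < m)
      (next : Fin m → Adversary m (Fin.snoc (α := fun _ => ℕ) D 1)) : Adversary m D
  | request {n : ℕ} {D : Fin n → ℕ} (j : Fin n) (hj : D j < m)
      (next : Fin m → Adversary m (Function.update D j (D j + 1))) : Adversary m D
  | toss {n : ℕ} {D : Fin n → ℕ} (μ : PMF ℕ) (next : ℕ → Adversary m D) : Adversary m D

/-- The outcome of a game: the number of activated instances, the orders in which they produce
their IDs, and the final demand profile. -/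
abbrev Outcome (m : ℕ) := Σ n : ℕ, (Fin n → Equiv.Perm (Fin m)) × (Fin n → ℕ)

/-- The final demand profile of a game. -/
def Outcome.profile {m : ℕ} (o : Outcome m) : Profile := ⟨o.1, o.2.2⟩

/-- The law of the outcome, when the instances active so far have drawn the orders `σ` (which the
adversary does not see).  Every newly activated instance draws its order from `A`, independently
of everything else. -/
def Adversary.play {m : ℕ} (A : Algorithm m) : {n : ℕ} → {D : Fin n → ℕ} →
    Adversary m D → (Fin n → Equiv.Perm (Fin m)) → PMF (Outcome m)
  | n, D, .halt, σ => PMF.pure ⟨n, σ, D⟩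
  | _, _, .activate hm next, σ =>
      A.bind fun τ => (next (τ ⟨0, hm⟩)).play A
        (Fin.snoc (α := fun _ => Equiv.Perm (Fin m)) σ τ)
  | _, D, .request j hj next, σ => (next (σ j ⟨D j, hj⟩)).play A σ
  | _, _, .toss μ next, σ => μ.bind fun r => (next r).play A σ

/-- Adaptive adversaries for the whole game, which starts at the empty profile. -/
abbrev Adaptive (m : ℕ) := Adversary m (![] : Fin 0 → ℕ)

/-- The law of the outcome of the game between `Z` and the instances of `A`. -/
def game {m : ℕ} (A : Algorithm m) (Z : Adaptive m) : PMF (Outcome m) :=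
  Z.play A ![]

open Classical in
/-- The probability `p_A(Z)` that a collision occurs in the game. -/
def adaptiveCollisionProb {m : ℕ} (A : Algorithm m) (Z : Adaptive m) : ℝ≥0∞ :=
  ∑' o : Outcome m, if Collision o.2.1 o.2.2 then game A Z o else 0

/-- The expectation of `p_*(D)` over the final demand profile `D` of the game. -/
def expectedOptProb {m : ℕ} (A : Algorithm m) (Z : Adaptive m) : ℝ≥0∞ :=
  ∑' o : Outcome m, game A Z o * optProb m o.profile

/-- `Adv(𝒟)`: the adversaries whose game against `A` can only end with a final demand profile
in `𝒟`. -/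
def Adv {m : ℕ} (A : Algorithm m) (𝒟 : Set Profile) : Set (Adaptive m) :=
  {Z | ∀ o ∈ (game A Z).support, o.profile ∈ 𝒟}

/-- The competitive ratio of `A` for `Adv(𝒟)`. -/
def adaptiveCompetitiveRatio {m : ℕ} (A : Algorithm m) (𝒟 : Set Profile) : ℝ≥0∞ :=
  ⨆ Z ∈ Adv A 𝒟, adaptiveCollisionProb A Z / expectedOptProb A Z

/-! ### The algorithm `BINS(k)` -/

/-- The `t`-th ID when the `⌊m/k⌋` bins `{rk, …, rk + k - 1}` are traversed in the order `π`, and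
then the leftover IDs in increasing order. -/
def binsFun (m k : ℕ) (π : Equiv.Perm (Fin (m / k))) (t : ℕ) : ℕ :=
  if h : t / k < m / k then (π ⟨t / k, h⟩ : ℕ) * k + t % k else t

theorem binsFun_lt (m k : ℕ) (π : Equiv.Perm (Fin (m / k))) {t : ℕ} (ht : t < m) :
    binsFun m k π t < m := by
  unfold binsFun
  split_ifs with h
  · have hk : 0 < k := by
      rcases Nat.eq_zero_or_pos k with rfl | hk
      · simp at h
      · exact hk
    have h1 := (π ⟨t / k, h⟩).isLt
    have h2 := Nat.mod_lt t hk
    have h3 : ((π ⟨t / k, h⟩ : ℕ) + 1) * k ≤ m / k * k := Nat.mul_le_mul_right k h1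
    have h4 := Nat.div_mul_le_self m k
    rw [Nat.add_mul] at h3
    omega
  · exact ht

theorem binsFun_symm (m k : ℕ) (π : Equiv.Perm (Fin (m / k))) (t : ℕ) :
    binsFun m k π.symm (binsFun m k π t) = t := by
  by_cases h : t / k < m / k
  · have hk : 0 < k := by
      rcases Nat.eq_zero_or_pos k with rfl | hk
      · simp at h
      · exact hk
    have e : binsFun m k π t = (π ⟨t / k, h⟩ : ℕ) * k + t % k := by simp [binsFun, h]
    have e1 : binsFun m k π t / k = (π ⟨t / k, h⟩ : ℕ) := by
      rw [e, Nat.add_comm, Nat.add_mul_div_right _ _ hk,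
        Nat.div_eq_of_lt (Nat.mod_lt t hk), Nat.zero_add]
    have e2 : binsFun m k π t % k = t % k := by
      rw [e, Nat.add_comm, Nat.add_mul_mod_self_right, Nat.mod_mod]
    conv_lhs => rw [binsFun]
    simp only [e1, e2, Fin.is_lt, dite_true, Fin.eta, Equiv.symm_apply_apply]
    exact Nat.div_add_mod' t k
  · have e : binsFun m k π t = t := by simp [binsFun, h]
    rw [e]
    simp [binsFun, h]

/-- The order of the IDs in `BINS(k)`, given the order `π` of the bins. -/
def binsPerm (m k : ℕ) (π : Equiv.Perm (Fin (m / k))) : Equiv.Perm (Fin m) where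
  toFun t := ⟨binsFun m k π t, binsFun_lt m k π t.isLt⟩
  invFun t := ⟨binsFun m k π.symm t, binsFun_lt m k π.symm t.isLt⟩
  left_inv t := Fin.ext (binsFun_symm m k π t)
  right_inv t := Fin.ext (by simpa using binsFun_symm m k π.symm t)

/-- The algorithm `BINS(k)`: the bins come in a uniformly random order. -/
def bins (m k : ℕ) : Algorithm m :=
  (PMF.uniformOfFintype (Equiv.Perm (Fin (m / k)))).map (binsPerm m k)

/-! ### The algorithm `BINS*` -/

/-- The number of chunks, `C = ⌈log m - log log m⌉` with logarithms to base 2. -/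
def chunks (m : ℕ) : ℕ := ⌈Real.logb 2 m - Real.logb 2 (Real.logb 2 m)⌉₊

theorem two_pow_chunks_le (m : ℕ) : 2 ^ chunks m ≤ m + 1 := by
  rcases Nat.lt_or_ge m 2 with h | h
  · have : chunks m = 0 := by
      interval_cases m <;> simp [chunks]
    rw [this]
    omega
  have hm : (0 : ℝ) < m := by positivity
  have hl : 1 ≤ Real.logb 2 m := by
    rw [Real.le_logb_iff_rpow_le (by norm_num) hm]
    norm_num
    exact_mod_cast h
  have hl0 : 0 < Real.logb 2 m := by linarith
  have e : Real.logb 2 m - Real.logb 2 (Real.logb 2 m) = Real.logb 2 (m / Real.logb 2 m) :=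
    (Real.logb_div hm.ne' hl0.ne').symm
  rcases Nat.lt_or_ge m 4 with h4 | h4
  · have : chunks m ≤ 1 := by
      unfold chunks
      rw [e, Nat.ceil_le, Real.logb_le_iff_le_rpow (by norm_num) (by positivity), div_le_iff₀ hl0]
      norm_num
      have h8 : (2 : ℝ) ^ (m : ℝ) ≤ (m : ℝ) ^ (2 : ℝ) := by
        interval_cases m <;> norm_num
      have h9 := Real.logb_le_logb_of_le (b := 2) (by norm_num) (by positivity) h8
      rw [Real.logb_rpow (by norm_num) (by norm_num), Real.logb_rpow_eq_mul_logb_of_pos hm] at h9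
      exact h9
    calc 2 ^ chunks m ≤ 2 ^ 1 := Nat.pow_le_pow_right (by norm_num) this
      _ ≤ m + 1 := by omega
  · have hl2 : 2 ≤ Real.logb 2 m := by
      rw [Real.le_logb_iff_rpow_le (by norm_num) hm]
      norm_num
      exact_mod_cast h4
    have hle : Real.logb 2 m ≤ m := by
      rw [Real.logb_le_iff_le_rpow (by norm_num) hm, Real.rpow_natCast]
      exact_mod_cast (Nat.lt_two_pow_self (n := m)).le
    have hpos : 0 ≤ Real.logb 2 (m / Real.logb 2 m) :=
      Real.logb_nonneg (by norm_num) ((one_le_div hl0).2 hle)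
    have hC : (chunks m : ℝ) ≤ Real.logb 2 (m / Real.logb 2 m) + 1 := by
      unfold chunks
      rw [e]
      exact (Nat.ceil_lt_add_one hpos).le
    have : (2 : ℝ) ^ (chunks m : ℝ) ≤ m := by
      calc (2 : ℝ) ^ (chunks m : ℝ) ≤ 2 ^ (Real.logb 2 (m / Real.logb 2 m) + 1) :=
            Real.rpow_le_rpow_of_exponent_le (by norm_num) hC
        _ = m / Real.logb 2 m * 2 := by
            rw [Real.rpow_add (by norm_num), Real.rpow_logb (by norm_num) (by norm_num)
              (by positivity), Real.rpow_one]
        _ ≤ m := by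
            rw [div_mul_eq_mul_div, div_le_iff₀ hl0]
            gcongr
    rw [Real.rpow_natCast] at this
    have h' : 2 ^ chunks m ≤ m := by exact_mod_cast this
    omega

/-- Chunks are counted from `0`.  The bin taken from chunk `i` has size `2 ^ i`, and its `j`-th ID
is produced after all the IDs of the bins of sizes `1, 2, …, 2 ^ (i - 1)`. -/
theorem time_lt {m : ℕ} (i : Fin (chunks m)) (j : Fin (2 ^ (i : ℕ))) :
    2 ^ (i : ℕ) - 1 + (j : ℕ) < m := by
  have h1 := two_pow_chunks_le m
  have h2 : 2 ^ ((i : ℕ) + 1) ≤ 2 ^ chunks m := Nat.pow_le_pow_right (by norm_num) i.isLt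
  have h3 := j.isLt
  have h4 : 0 < 2 ^ (i : ℕ) := by positivity
  rw [pow_succ] at h2
  omega

/-- `A` is (an implementation of) `BINS*`.  The chunks `0, …, C - 1` are consecutive blocks of
`2 ^ (C - 1)` IDs, and chunk `i` consists of `2 ^ (C - 1 - i)` consecutive bins of size `2 ^ i`.
For each `i` in turn, the bin with a uniformly random number `b i` (independent for different `i`)
of chunk `i` is returned in increasing order.  What happens after the bin from the last chunk has
been exhausted, that is, after `2 ^ C - 1` IDs, is not specified by `BINS*`. -/
def IsBinsStar {m : ℕ} (A : Algorithm m) : Prop :=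
  A.map (fun σ (i : Fin (chunks m)) (j : Fin (2 ^ (i : ℕ))) =>
      (σ ⟨2 ^ (i : ℕ) - 1 + (j : ℕ), time_lt i j⟩ : ℕ)) =
    (PMF.uniformOfFintype ((i : Fin (chunks m)) → Fin (2 ^ (chunks m - 1 - (i : ℕ))))).map
      (fun b (i : Fin (chunks m)) (j : Fin (2 ^ (i : ℕ))) =>
        (i : ℕ) * 2 ^ (chunks m - 1) + (b i : ℕ) * 2 ^ (i : ℕ) + (j : ℕ))

end UUID

end

/-! Call the *hazard* of a request the conditional probability that it produces the first collision,
given the IDs returned so far.  For both algorithms the hazard `h` depends on the demand profile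
alone, not on the IDs: under `BINS(k)` and `BINS*` only the first ID of a bin can produce a first
collision, and this ID is uniform on a set that contains a fixed number of IDs of every other
instance.  So for each request `D → D'` the oblivious collision probability
`p D := collisionProb A D` satisfies `p D' + h * p D = p D + h`.

Consequently, as long as no collision has occurred,
`P(collision in the rest of the game) + p D ≤ 2 * E[p (final profile)]`.
By backward induction it suffices to look at one request.  With probability `h` it produces a
collision, after which only `P ≤ 1` and `p D' ≤ E[p (final profile)]` are available, so the
inequality degrades to `P + 2 * p D' ≤ 1 + 2 * E`; the loss `h * (1 - p D')` is at most the gain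
`p D' - p D = h * (1 - p D)`.  At the start of the game this bounds the adaptive collision
probability by twice the expected oblivious one. -/

namespace UUID

open Finset

variable {m n : ℕ}

/-! ### Expectations -/

section Expect

variable {α β : Type*}

/-- The expectation of an `ℝ≥0∞`-valued function under a discrete distribution. -/
noncomputable def expect (μ : PMF α) (f : α → ℝ≥0∞) : ℝ≥0∞ := ∑' a, μ a * f a

theorem expect_pure (a : α) (f : α → ℝ≥0∞) : expect (PMF.pure a) f = f a := by
  rw [expect, tsum_eq_single a fun b hb => by simp [hb]]
  simp

theorem expect_bind (μ : PMF α) (κ : α → PMF β) (f : β → ℝ≥0∞) :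
    expect (μ.bind κ) f = expect μ fun a => expect (κ a) f := by
  simp only [expect, PMF.bind_apply, ← ENNReal.tsum_mul_right, ← ENNReal.tsum_mul_left]
  rw [ENNReal.tsum_comm]
  simp only [mul_assoc]

theorem expect_mono (μ : PMF α) {f g : α → ℝ≥0∞} (h : ∀ a ∈ μ.support, f a ≤ g a) :
    expect μ f ≤ expect μ g := by
  refine ENNReal.tsum_le_tsum fun a => ?_
  by_cases ha : a ∈ μ.support
  · gcongr
    exact h a ha
  · simp [(μ.apply_eq_zero_iff a).2 ha]

theorem expect_const (μ : PMF α) (c : ℝ≥0∞) : expect μ (fun _ => c) = c := by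
  rw [expect, ENNReal.tsum_mul_right, μ.tsum_coe, one_mul]

theorem expect_add (μ : PMF α) (f g : α → ℝ≥0∞) :
    expect μ (fun a => f a + g a) = expect μ f + expect μ g := by
  simp only [expect, mul_add, ENNReal.tsum_add]

theorem expect_const_mul (μ : PMF α) (c : ℝ≥0∞) (f : α → ℝ≥0∞) :
    expect μ (fun a => c * f a) = c * expect μ f := by
  simp only [expect, mul_left_comm _ c, ENNReal.tsum_mul_left]

theorem expect_le_one (μ : PMF α) {f : α → ℝ≥0∞} (hf : ∀ a, f a ≤ 1) : expect μ f ≤ 1 :=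
  (expect_mono μ fun a _ => hf a).trans_eq (expect_const μ 1)

theorem le_expect (μ : PMF α) {f : α → ℝ≥0∞} {c : ℝ≥0∞} (hf : ∀ a, c ≤ f a) :
    c ≤ expect μ f :=
  (expect_const μ c).symm.trans_le (expect_mono μ fun a _ => hf a)

end Expect

theorem sum_le_sum_of_forall_cell {α : Type*} {s : Finset α} (cell : α → Finset α)
    (hcell : ∀ a b, b ∈ cell a ↔ cell b = cell a) (hsub : ∀ a ∈ s, cell a ⊆ s) {f g : α → ℝ≥0∞}
    (h : ∀ a ∈ s, ∑ b ∈ cell a, f b ≤ ∑ b ∈ cell a, g b) : ∑ b ∈ s, f b ≤ ∑ b ∈ s, g b := by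
  classical
  have hmaps : ∀ a ∈ s, cell a ∈ s.image cell := fun a ha => mem_image_of_mem cell ha
  rw [← sum_fiberwise_of_maps_to hmaps f, ← sum_fiberwise_of_maps_to hmaps g]
  refine sum_le_sum fun c hc => ?_
  obtain ⟨a, ha, rfl⟩ := mem_image.1 hc
  have hfiber : {b ∈ s | cell b = cell a} = cell a := by
    ext b
    rw [mem_filter, ← hcell]
    exact and_iff_right_of_imp fun hb => hsub a ha hb
  rw [hfiber]
  exact h a ha

/-! ### Histories -/

/-- The orders whose first `d` IDs are those of `σ`. -/
def cylinder (d : ℕ) (σ : Equiv.Perm (Fin m)) : Finset (Equiv.Perm (Fin m)) :=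
  {τ | ∀ a : Fin m, (a : ℕ) < d → τ a = σ a}

theorem mem_cylinder {d : ℕ} {σ τ : Equiv.Perm (Fin m)} :
    τ ∈ cylinder d σ ↔ ∀ a : Fin m, (a : ℕ) < d → τ a = σ a := by
  simp [cylinder]

/-- The orders of `n` instances from which the profile `D` elicits the same IDs as from `σ`.  The
IDs that an adversary has seen are recorded by any one representative `σ` of such a class. -/
def history (D : Fin n → ℕ) (σ : Fin n → Equiv.Perm (Fin m)) :
    Finset (Fin n → Equiv.Perm (Fin m)) :=
  Fintype.piFinset fun i => cylinder (D i) (σ i)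

section History

variable {D D' : Fin n → ℕ} {σ τ : Fin n → Equiv.Perm (Fin m)}

theorem mem_history : τ ∈ history D σ ↔ ∀ i, ∀ a : Fin m, (a : ℕ) < D i → τ i a = σ i a := by
  simp [history, mem_cylinder]

theorem mem_history_iff_eq : τ ∈ history D σ ↔ history D τ = history D σ := by
  constructor
  · intro h
    ext υ
    simp only [mem_history] at h ⊢
    exact forall₃_congr fun i a ha => by rw [h i a ha]
  · rintro h
    rw [← h, mem_history]
    exact fun _ _ _ => rfl

theorem history_subset_of_mem (hD : D ≤ D') (hτ : τ ∈ history D σ) :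
    history D' τ ⊆ history D σ := fun υ hυ => by
  rw [mem_history] at *
  exact fun i a ha => (hυ i a (ha.trans_le (hD i))).trans (hτ i a ha)

theorem history_zero (σ : Fin n → Equiv.Perm (Fin m)) : history 0 σ = univ := by
  ext
  simp [mem_history]

theorem Collision.of_mem_history (hτ : τ ∈ history D σ) (h : Collision σ D) : Collision τ D := by
  obtain ⟨i, j, hij, a, b, ha, hb, e⟩ := h
  rw [mem_history] at hτ
  exact ⟨i, j, hij, a, b, ha, hb, by rw [hτ i a ha, hτ j b hb, e]⟩

theorem collision_iff_of_mem_history (hτ : τ ∈ history D σ) : Collision τ D ↔ Collision σ D :=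
  ⟨.of_mem_history (mem_history_iff_eq.2 (mem_history_iff_eq.1 hτ).symm), .of_mem_history hτ⟩

theorem Collision.mono (hD : D ≤ D') (h : Collision σ D) : Collision σ D' := by
  obtain ⟨i, j, hij, a, b, ha, hb, e⟩ := h
  exact ⟨i, j, hij, a, b, ha.trans_le (hD i), hb.trans_le (hD j), e⟩

end History

/-- The expectation of `f` restricted to the event that independent instances of `A` return the IDs
in the history of `σ`.  It is not normalized: the value at `f = 1` is the probability of the
history. -/
noncomputable def histExpect (A : Algorithm m) (D : Fin n → ℕ) (σ : Fin n → Equiv.Perm (Fin m))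
    (f : (Fin n → Equiv.Perm (Fin m)) → ℝ≥0∞) : ℝ≥0∞ :=
  ∑ τ ∈ history D σ, (∏ i, A (τ i)) * f τ

section HistExpect

variable (A : Algorithm m) (D : Fin n → ℕ) (σ : Fin n → Equiv.Perm (Fin m))
  {f g : (Fin n → Equiv.Perm (Fin m)) → ℝ≥0∞}

theorem histExpect_add (f g : (Fin n → Equiv.Perm (Fin m)) → ℝ≥0∞) :
    histExpect A D σ (fun τ => f τ + g τ) = histExpect A D σ f + histExpect A D σ g := by
  simp only [histExpect, mul_add, sum_add_distrib]

theorem histExpect_const_mul (c : ℝ≥0∞) (f : (Fin n → Equiv.Perm (Fin m)) → ℝ≥0∞) :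
    histExpect A D σ (fun τ => c * f τ) = c * histExpect A D σ f := by
  simp only [histExpect, mul_sum, mul_left_comm c]

theorem histExpect_const (c : ℝ≥0∞) :
    histExpect A D σ (fun _ => c) = c * histExpect A D σ 1 := by
  rw [← histExpect_const_mul]
  simp

theorem histExpect_expect {α : Type*} (μ : PMF α)
    (F : α → (Fin n → Equiv.Perm (Fin m)) → ℝ≥0∞) :
    histExpect A D σ (fun τ => expect μ fun r => F r τ) =
      expect μ fun r => histExpect A D σ (F r) := by
  simp only [histExpect, expect, mul_sum, ← ENNReal.tsum_mul_left]
  rw [Summable.tsum_finsetSum fun _ _ => ENNReal.summable]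
  simp only [mul_left_comm]

variable {A D σ}

theorem histExpect_mono (h : ∀ τ ∈ history D σ, f τ ≤ g τ) :
    histExpect A D σ f ≤ histExpect A D σ g :=
  sum_le_sum fun τ hτ => by gcongr; exact h τ hτ

theorem histExpect_congr (h : ∀ τ ∈ history D σ, f τ = g τ) :
    histExpect A D σ f = histExpect A D σ g :=
  sum_congr rfl fun τ hτ => by rw [h τ hτ]

theorem histExpect_eq_zero (h : ∀ τ ∈ history D σ, (∀ i, τ i ∈ A.support) → f τ = 0) :
    histExpect A D σ f = 0 := by
  refine sum_eq_zero fun τ hτ => ?_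
  by_cases hs : ∀ i, τ i ∈ A.support
  · rw [h τ hτ hs, mul_zero]
  · obtain ⟨i, hi⟩ := not_forall.1 hs
    rw [prod_eq_zero (mem_univ i) ((A.apply_eq_zero_iff _).2 hi), zero_mul]

theorem histExpect_le_of_refine {D' : Fin n → ℕ} (hD : D ≤ D')
    (h : ∀ τ ∈ history D σ, histExpect A D' τ f ≤ histExpect A D' τ g) :
    histExpect A D σ f ≤ histExpect A D σ g :=
  sum_le_sum_of_forall_cell (history D') (fun _ _ => mem_history_iff_eq)
    (fun _ hτ => history_subset_of_mem hD hτ) h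

theorem histExpect_zero_one (A : Algorithm m) (σ : Fin n → Equiv.Perm (Fin m)) :
    histExpect A 0 σ 1 = 1 := by
  have hA : ∑ τ, A τ = 1 := by rw [← tsum_fintype (L := .unconditional _), A.tsum_coe]
  simp [histExpect, history_zero, ← Fintype.prod_sum, hA]

theorem histExpect_le_one (hf : ∀ τ, f τ ≤ 1) : histExpect A D σ f ≤ 1 := by
  rw [← histExpect_zero_one A σ, histExpect, histExpect, history_zero]
  exact (sum_le_sum fun τ _ => by gcongr; exact hf τ).trans
    (sum_le_sum_of_subset (subset_univ _))

end HistExpect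

open Classical in
/-- The indicator function of a collision, the random variable whose expectation is the collision
probability. -/
noncomputable def collisionIndicator (D : Fin n → ℕ) (σ : Fin n → Equiv.Perm (Fin m)) : ℝ≥0∞ :=
  if Collision σ D then 1 else 0

section CollisionProb

variable {D D' : Fin n → ℕ} {σ : Fin n → Equiv.Perm (Fin m)}

theorem collisionIndicator_of_collision (h : Collision σ D) : collisionIndicator D σ = 1 :=
  if_pos h

theorem collisionIndicator_of_not_collision (h : ¬ Collision σ D) : collisionIndicator D σ = 0 :=
  if_neg h

theorem collisionIndicator_le_one (D : Fin n → ℕ) (σ : Fin n → Equiv.Perm (Fin m)) :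
    collisionIndicator D σ ≤ 1 := by
  unfold collisionIndicator
  split_ifs <;> simp

theorem collisionIndicator_mono (hD : D ≤ D') (σ : Fin n → Equiv.Perm (Fin m)) :
    collisionIndicator D σ ≤ collisionIndicator D' σ := by
  by_cases h : Collision σ D
  · rw [collisionIndicator_of_collision (h.mono hD)]
    exact collisionIndicator_le_one D σ
  · simp [collisionIndicator_of_not_collision h]

theorem collisionProb_eq_histExpect (A : Algorithm m) (D : Fin n → ℕ)
    (σ : Fin n → Equiv.Perm (Fin m)) :
    collisionProb A ⟨n, D⟩ = histExpect A 0 σ (collisionIndicator D) := by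
  simp only [collisionProb, histExpect, history_zero, collisionIndicator, mul_ite, mul_one,
    mul_zero]

theorem collisionProb_mono (A : Algorithm m) (hD : D ≤ D') :
    collisionProb A ⟨n, D⟩ ≤ collisionProb A ⟨n, D'⟩ := by
  rw [collisionProb_eq_histExpect A D 1, collisionProb_eq_histExpect A D' 1]
  exact histExpect_mono fun τ _ => collisionIndicator_mono hD τ

theorem collisionProb_le_one (A : Algorithm m) (D : Profile) : collisionProb A D ≤ 1 := by
  rw [← Sigma.eta D, collisionProb_eq_histExpect A D.2 1]
  exact histExpect_le_one fun τ => collisionIndicator_le_one D.2 τ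

end CollisionProb

/-! ### The hazard of a request -/

/-- `h` is the hazard of passing from the profile `D` to `D'`: given any history without a
collision at `D`, there is a collision at `D'` with conditional probability `h`. -/
def IsHazard (A : Algorithm m) (D D' : Fin n → ℕ) (h : ℝ≥0∞) : Prop :=
  ∀ σ, ¬ Collision σ D → histExpect A D σ (collisionIndicator D') = h * histExpect A D σ 1

/-- Every request that keeps the demands at most `M` has a hazard that is determined by the
demand profile. -/
def HasProfileHazard (A : Algorithm m) (M : ℕ) : Prop :=
  ∀ ⦃n : ℕ⦄ (D : Fin n → ℕ) (j : Fin n), D j < m →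
    (∀ i, Function.update D j (D j + 1) i ≤ M) →
    ∃ h, IsHazard A D (Function.update D j (D j + 1)) h

namespace IsHazard

variable {A : Algorithm m} {D D' : Fin n → ℕ} {h : ℝ≥0∞}

/-- `p D' = p D + h * (1 - p D)`, rearranged so that no subtraction occurs. -/
theorem collisionProb_add_mul (hh : IsHazard A D D' h) (hD : D ≤ D') :
    collisionProb A ⟨n, D'⟩ + h * collisionProb A ⟨n, D⟩ = collisionProb A ⟨n, D⟩ + h := by
  have hcell (τ : Fin n → Equiv.Perm (Fin m)) :
      histExpect A D τ (fun υ => collisionIndicator D' υ + h * collisionIndicator D υ) =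
        histExpect A D τ (fun υ => collisionIndicator D υ + h) := by
    by_cases hτ : Collision τ D
    · refine histExpect_congr fun υ hυ => ?_
      have hυ' := hτ.of_mem_history hυ
      simp only [collisionIndicator_of_collision hυ',
        collisionIndicator_of_collision (hυ'.mono hD), mul_one]
    · have hzero : histExpect A D τ (collisionIndicator D) = 0 :=
        histExpect_eq_zero fun υ hυ _ => collisionIndicator_of_not_collision <| by
          rwa [collision_iff_of_mem_history hυ]
      rw [histExpect_add, histExpect_add, histExpect_const_mul, histExpect_const, hzero, hh τ hτ,
        mul_zero, add_zero, zero_add]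
  have hsum := le_antisymm
    (histExpect_le_of_refine (σ := 1) zero_le fun τ _ => (hcell τ).le)
    (histExpect_le_of_refine (σ := 1) zero_le fun τ _ => (hcell τ).ge)
  rwa [histExpect_add, histExpect_add, histExpect_const_mul, histExpect_const,
    histExpect_zero_one, mul_one, ← collisionProb_eq_histExpect, ← collisionProb_eq_histExpect]
    at hsum

/-- One step of the backward induction: `X` and `E` stand for the probability of a collision in the
rest of the game and the expectation of `collisionProb` at the final profile. -/
theorem histExpect_add_collisionProb_le (hh : IsHazard A D D' h) (hD : D ≤ D')
    {σ : Fin n → Equiv.Perm (Fin m)} (hσ : ¬ Collision σ D)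
    {X E : (Fin n → Equiv.Perm (Fin m)) → ℝ≥0∞} (hX : ∀ τ, X τ ≤ 1)
    (hE : ∀ τ, collisionProb A ⟨n, D'⟩ ≤ E τ)
    (hnext : ∀ τ ∈ history D σ, ¬ Collision τ D' →
      histExpect A D' τ (fun υ => X υ + collisionProb A ⟨n, D'⟩) ≤
        histExpect A D' τ (fun υ => 2 * E υ)) :
    histExpect A D σ (fun τ => X τ + collisionProb A ⟨n, D⟩) ≤
      histExpect A D σ (fun τ => 2 * E τ) := by
  set p := collisionProb A ⟨n, D⟩
  set p' := collisionProb A ⟨n, D'⟩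
  set W := histExpect A D σ 1
  have hloss : histExpect A D σ (fun τ => X τ + p' + p' * collisionIndicator D' τ) ≤
      histExpect A D σ (fun τ => 2 * E τ + collisionIndicator D' τ) := by
    refine histExpect_le_of_refine hD fun τ hτ => ?_
    by_cases hc : Collision τ D'
    · refine histExpect_mono fun υ hυ => ?_
      rw [collisionIndicator_of_collision (hc.of_mem_history hυ), mul_one]
      calc X υ + p' + p' ≤ 1 + E υ + E υ := by gcongr; exacts [hX υ, hE υ, hE υ]
        _ = 2 * E υ + 1 := by ring
    · have hzero : ∀ υ ∈ history D' τ, collisionIndicator D' υ = 0 := fun υ hυ =>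
        collisionIndicator_of_not_collision (by rwa [collision_iff_of_mem_history hυ])
      calc histExpect A D' τ (fun υ => X υ + p' + p' * collisionIndicator D' υ)
        _ = histExpect A D' τ (fun υ => X υ + p') :=
            histExpect_congr fun υ hυ => by rw [hzero υ hυ, mul_zero, add_zero]
        _ ≤ histExpect A D' τ (fun υ => 2 * E υ) := hnext τ hτ hc
        _ ≤ histExpect A D' τ (fun υ => 2 * E υ + collisionIndicator D' υ) :=
            histExpect_mono fun υ _ => le_self_add
  have hgain : p + h ≤ p' + p' * h := by
    rw [← hh.collisionProb_add_mul hD, mul_comm p' h]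
    gcongr
    exact collisionProb_mono A hD
  rw [histExpect_add, histExpect_add, histExpect_add, histExpect_const_mul A D σ p',
    histExpect_const, hh σ hσ] at hloss
  have hfin : h * W ≠ ⊤ := by
    rw [← hh σ hσ]
    exact ne_top_of_le_ne_top ENNReal.one_ne_top (histExpect_le_one (collisionIndicator_le_one D'))
  rw [histExpect_add, histExpect_const]
  refine (ENNReal.add_le_add_iff_right hfin).1 ?_
  calc histExpect A D σ X + p * W + h * W = histExpect A D σ X + (p + h) * W := by ring
    _ ≤ histExpect A D σ X + (p' + p' * h) * W := by gcongr
    _ = histExpect A D σ X + p' * W + p' * (h * W) := by ring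
    _ ≤ histExpect A D σ (fun τ => 2 * E τ) + h * W := hloss

end IsHazard

theorem le_update_succ (D : Fin n → ℕ) (j : Fin n) : D ≤ Function.update D j (D j + 1) :=
  le_update_iff.2 ⟨Nat.le_succ _, fun _ _ => le_rfl⟩

/-! ### Activation of an instance

Activating an instance amounts to adding an entry `0` to the profile and then requesting one ID
from the new instance. -/

section Snoc

variable {D : Fin n → ℕ} {σ : Fin n → Equiv.Perm (Fin m)}

theorem snoc_one_eq (D : Fin n → ℕ) :
    (Fin.snoc (α := fun _ => ℕ) D 1 : Fin (n + 1) → ℕ) =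
      Function.update (Fin.snoc (α := fun _ => ℕ) D 0) (Fin.last n)
        ((Fin.snoc (α := fun _ => ℕ) D 0 : Fin (n + 1) → ℕ) (Fin.last n) + 1) := by
  rw [Fin.snoc_last, Fin.update_snoc_last]

theorem collision_snoc_zero_iff {υ : Equiv.Perm (Fin m)} :
    Collision (Fin.snoc (α := fun _ => Equiv.Perm (Fin m)) σ υ)
      (Fin.snoc (α := fun _ => ℕ) D 0) ↔ Collision σ D := by
  constructor
  · rintro ⟨i, j, hij, a, b, ha, hb, e⟩
    induction i using Fin.lastCases with
    | last => simp at ha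
    | cast i =>
      induction j using Fin.lastCases with
      | last => simp at hb
      | cast j =>
        simp only [Fin.snoc_castSucc] at ha hb e
        exact ⟨i, j, fun h => hij (by rw [h]), a, b, ha, hb, e⟩
  · rintro ⟨i, j, hij, a, b, ha, hb, e⟩
    exact ⟨i.castSucc, j.castSucc, fun h => hij (Fin.castSucc_injective _ h), a, b,
      by simpa using ha, by simpa using hb, by simpa using e⟩

theorem collisionIndicator_snoc_zero {υ : Equiv.Perm (Fin m)} :
    collisionIndicator (Fin.snoc (α := fun _ => ℕ) D 0)
      (Fin.snoc (α := fun _ => Equiv.Perm (Fin m)) σ υ) = collisionIndicator D σ := by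
  rw [collisionIndicator, collisionIndicator, collision_snoc_zero_iff]

theorem snoc_mem_history_iff {τ : Fin n → Equiv.Perm (Fin m)} {υ υ₀ : Equiv.Perm (Fin m)} :
    (Fin.snoc (α := fun _ => Equiv.Perm (Fin m)) τ υ : Fin (n + 1) → Equiv.Perm (Fin m)) ∈
        history (Fin.snoc (α := fun _ => ℕ) D 0)
          (Fin.snoc (α := fun _ => Equiv.Perm (Fin m)) σ υ₀) ↔
      τ ∈ history D σ := by
  simp [mem_history, Fin.forall_fin_succ']

theorem histExpect_snoc_zero (A : Algorithm m) (D : Fin n → ℕ) (σ : Fin n → Equiv.Perm (Fin m))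
    (υ₀ : Equiv.Perm (Fin m)) (F : (Fin (n + 1) → Equiv.Perm (Fin m)) → ℝ≥0∞) :
    histExpect A (Fin.snoc (α := fun _ => ℕ) D 0)
        (Fin.snoc (α := fun _ => Equiv.Perm (Fin m)) σ υ₀) F =
      histExpect A D σ fun τ =>
        expect A fun υ => F (Fin.snoc (α := fun _ => Equiv.Perm (Fin m)) τ υ) := by
  simp only [histExpect, expect, tsum_fintype, mul_sum]
  rw [← sum_product']
  refine (sum_bij' (fun x _ => Fin.snoc (α := fun _ => Equiv.Perm (Fin m)) x.1 x.2)
    (fun τ _ => (Fin.init τ, τ (Fin.last n))) ?_ ?_ ?_ ?_ ?_).symm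
  · exact fun x hx => snoc_mem_history_iff.2 (mem_product.1 hx).1
  · intro τ hτ
    rw [← Fin.snoc_init_self τ, snoc_mem_history_iff] at hτ
    simpa using hτ
  · simp
  · simp
  · intro x _
    simp only [Fin.prod_univ_castSucc, Fin.snoc_castSucc, Fin.snoc_last, mul_assoc]

theorem collisionProb_snoc_zero (A : Algorithm m) (D : Fin n → ℕ) :
    collisionProb A ⟨n + 1, Fin.snoc (α := fun _ => ℕ) D 0⟩ = collisionProb A ⟨n, D⟩ := by
  have hzero : (0 : Fin (n + 1) → ℕ) = Fin.snoc (α := fun _ => ℕ) (0 : Fin n → ℕ) 0 := by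
    ext i
    induction i using Fin.lastCases <;> simp
  rw [collisionProb_eq_histExpect A _ (Fin.snoc (α := fun _ => Equiv.Perm (Fin m)) 1 1), hzero,
    histExpect_snoc_zero, collisionProb_eq_histExpect A D 1]
  simp only [collisionIndicator_snoc_zero, expect_const]

theorem collisionProb_le_snoc_one (A : Algorithm m) (D : Fin n → ℕ) :
    collisionProb A ⟨n, D⟩ ≤ collisionProb A ⟨n + 1, Fin.snoc (α := fun _ => ℕ) D 1⟩ := by
  rw [← collisionProb_snoc_zero, snoc_one_eq]
  exact collisionProb_mono A (le_update_succ _ _)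

end Snoc

/-! ### The game -/

namespace Adversary

/-- The probability of a collision at the end of the game that `Z` continues when the active
instances have drawn the orders `σ`. -/
noncomputable def collisionRisk (A : Algorithm m) {D : Fin n → ℕ} (Z : Adversary m D)
    (σ : Fin n → Equiv.Perm (Fin m)) : ℝ≥0∞ :=
  expect (Z.play A σ) fun o => collisionIndicator o.2.2 o.2.1

/-- The expectation of `collisionProb A` at the final profile of the game that `Z` continues when
the active instances have drawn the orders `σ`. -/
noncomputable def finalCollisionProb (A : Algorithm m) {D : Fin n → ℕ} (Z : Adversary m D)
    (σ : Fin n → Equiv.Perm (Fin m)) : ℝ≥0∞ :=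
  expect (Z.play A σ) fun o => collisionProb A o.profile

/-- In the games that `Z` continues from the history of `σ`, no final demand exceeds `M`. -/
def DemandsLe (A : Algorithm m) (M : ℕ) {D : Fin n → ℕ} (Z : Adversary m D)
    (σ : Fin n → Equiv.Perm (Fin m)) : Prop :=
  ∀ τ ∈ history D σ, (∀ i, τ i ∈ A.support) → ∀ o ∈ (Z.play A τ).support, ∀ i, o.2.2 i ≤ M

variable {A : Algorithm m} {M : ℕ}

theorem collisionRisk_le_one {D : Fin n → ℕ} (Z : Adversary m D)
    (σ : Fin n → Equiv.Perm (Fin m)) : collisionRisk A Z σ ≤ 1 :=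
  expect_le_one _ fun o => collisionIndicator_le_one o.2.2 o.2.1

theorem collisionProb_le_finalCollisionProb {D : Fin n → ℕ} (Z : Adversary m D)
    (σ : Fin n → Equiv.Perm (Fin m)) : collisionProb A ⟨n, D⟩ ≤ finalCollisionProb A Z σ := by
  unfold finalCollisionProb
  induction Z with
  | halt => exact (expect_pure _ _).ge
  | activate hm next ih =>
    rw [play, expect_bind]
    exact le_expect A fun τ => (collisionProb_le_snoc_one A _).trans (ih _ _)
  | request j hj next ih =>
    exact (collisionProb_mono A (le_update_succ _ _)).trans (ih _ _)
  | toss μ next ih =>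
    rw [play, expect_bind]
    exact le_expect μ fun r => ih r σ

theorem le_of_forall_play_le {D : Fin n → ℕ} (Z : Adversary m D) (σ : Fin n → Equiv.Perm (Fin m))
    (h : ∀ o ∈ (Z.play A σ).support, ∀ i, o.2.2 i ≤ M) (i : Fin n) : D i ≤ M := by
  induction Z with
  | halt => exact h ⟨_, σ, _⟩ (PMF.mem_support_pure_iff _ _ |>.2 rfl) i
  | @activate n D hm next ih =>
    obtain ⟨τ, hτ⟩ := A.support_nonempty
    have hplay := ih (τ ⟨0, hm⟩) (Fin.snoc (α := fun _ => Equiv.Perm (Fin m)) σ τ)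
      (fun o ho => h o (PMF.mem_support_bind_iff _ _ _ |>.2 ⟨τ, hτ, ho⟩)) i.castSucc
    rwa [Fin.snoc_castSucc] at hplay
  | request j hj next ih => exact (le_update_succ _ _ i).trans (ih _ σ h i)
  | toss μ next ih =>
    obtain ⟨r, hr⟩ := μ.support_nonempty
    exact ih r σ (fun o ho => h o (PMF.mem_support_bind_iff _ _ _ |>.2 ⟨r, hr, ho⟩)) i

theorem histExpect_le_of_next (hA : HasProfileHazard A M) {D D' : Fin n → ℕ} {j : Fin n}
    (hj : D j < m) (hD' : D' = Function.update D j (D j + 1)) (next : Fin m → Adversary m D')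
    {σ : Fin n → Equiv.Perm (Fin m)} (hσ : ¬ Collision σ D)
    (hM : ∀ τ ∈ history D σ, (∀ i, τ i ∈ A.support) →
      ∀ o ∈ ((next (τ j ⟨D j, hj⟩)).play A τ).support, ∀ i, o.2.2 i ≤ M)
    (ih : ∀ x τ, ¬ Collision τ D' → DemandsLe A M (next x) τ →
      histExpect A D' τ (fun υ => collisionRisk A (next x) υ + collisionProb A ⟨n, D'⟩) ≤
        histExpect A D' τ (fun υ => 2 * finalCollisionProb A (next x) υ)) :
    histExpect A D σ
        (fun τ => collisionRisk A (next (τ j ⟨D j, hj⟩)) τ + collisionProb A ⟨n, D⟩) ≤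
      histExpect A D σ (fun τ => 2 * finalCollisionProb A (next (τ j ⟨D j, hj⟩)) τ) := by
  by_cases hsupp : ∃ τ ∈ history D σ, ∀ i, τ i ∈ A.support
  swap
  · push Not at hsupp
    rw [histExpect_eq_zero fun τ hτ hs => absurd hs (by simpa using hsupp τ hτ)]
    exact zero_le
  have hle : D ≤ D' := hD' ▸ le_update_succ D j
  have hDM : ∀ i, D' i ≤ M := by
    obtain ⟨τ, hτ, hs⟩ := hsupp
    exact le_of_forall_play_le _ τ (hM τ hτ hs)
  obtain ⟨h, hh⟩ := hA D j hj (hD' ▸ hDM)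
  rw [← hD'] at hh
  refine hh.histExpect_add_collisionProb_le hle hσ (fun τ => collisionRisk_le_one _ τ)
    (fun τ => collisionProb_le_finalCollisionProb _ τ) fun τ hτ hc => ?_
  have hanswer : ∀ υ ∈ history D' τ, υ j ⟨D j, hj⟩ = τ j ⟨D j, hj⟩ := fun υ hυ =>
    mem_history.1 hυ j _ (by simp [hD'])
  convert ih (τ j ⟨D j, hj⟩) τ hc fun υ hυ hs => ?_ using 1
  · exact histExpect_congr fun υ hυ => by rw [hanswer υ hυ]
  · exact histExpect_congr fun υ hυ => by rw [hanswer υ hυ]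
  · rw [← hanswer υ hυ]
    exact hM υ (history_subset_of_mem hle hτ hυ) hs

theorem histExpect_activate_le (hA : HasProfileHazard A M) {D : Fin n → ℕ} (hm : 0 < m)
    (next : Fin m → Adversary m (Fin.snoc (α := fun _ => ℕ) D 1))
    {σ : Fin n → Equiv.Perm (Fin m)} (hσ : ¬ Collision σ D)
    (hM : DemandsLe A M (.activate hm next) σ)
    (ih : ∀ x τ, ¬ Collision τ (Fin.snoc (α := fun _ => ℕ) D 1) → DemandsLe A M (next x) τ →
      histExpect A (Fin.snoc (α := fun _ => ℕ) D 1) τ (fun υ => collisionRisk A (next x) υ +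
          collisionProb A ⟨n + 1, Fin.snoc (α := fun _ => ℕ) D 1⟩) ≤
        histExpect A (Fin.snoc (α := fun _ => ℕ) D 1) τ
          (fun υ => 2 * finalCollisionProb A (next x) υ)) :
    histExpect A D σ (fun τ => collisionRisk A (.activate hm next) τ + collisionProb A ⟨n, D⟩) ≤
      histExpect A D σ (fun τ => 2 * finalCollisionProb A (.activate hm next) τ) := by
  have hj : (Fin.snoc (α := fun _ => ℕ) D 0 : Fin (n + 1) → ℕ) (Fin.last n) < m := by simpa
  have htime : (⟨_, hj⟩ : Fin m) = ⟨0, hm⟩ := by simp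
  have hstep := histExpect_le_of_next hA hj (snoc_one_eq D) next
    (σ := Fin.snoc (α := fun _ => Equiv.Perm (Fin m)) σ 1) (mt collision_snoc_zero_iff.1 hσ) ?_ ih
  · simpa only [htime, histExpect_snoc_zero, Fin.snoc_last, expect_add, expect_const,
      expect_const_mul, collisionProb_snoc_zero, collisionRisk, finalCollisionProb, play,
      expect_bind] using hstep
  intro τ hτ hs o ho
  rw [← Fin.snoc_init_self τ, snoc_mem_history_iff] at hτ
  refine hM (Fin.init τ) hτ (fun i => hs i.castSucc) o ?_
  rw [play, PMF.mem_support_bind_iff]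
  refine ⟨τ (Fin.last n), hs _, ?_⟩
  rwa [Fin.snoc_init_self, ← htime]

theorem histExpect_toss_le {D : Fin n → ℕ} (μ : PMF ℕ) (next : ℕ → Adversary m D)
    {σ : Fin n → Equiv.Perm (Fin m)} (hM : DemandsLe A M (.toss μ next) σ)
    (ih : ∀ r, DemandsLe A M (next r) σ →
      histExpect A D σ (fun τ => collisionRisk A (next r) τ + collisionProb A ⟨n, D⟩) ≤
        histExpect A D σ (fun τ => 2 * finalCollisionProb A (next r) τ)) :
    histExpect A D σ (fun τ => collisionRisk A (.toss μ next) τ + collisionProb A ⟨n, D⟩) ≤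
      histExpect A D σ (fun τ => 2 * finalCollisionProb A (.toss μ next) τ) := by
  have hstep := expect_mono μ fun r hr => ih r fun τ hτ hs o ho => hM τ hτ hs o <|
    PMF.mem_support_bind_iff _ _ _ |>.2 ⟨r, hr, ho⟩
  simpa only [← histExpect_expect, expect_add, expect_const, expect_const_mul, collisionRisk,
    finalCollisionProb, play, expect_bind] using hstep

theorem histExpect_collisionRisk_add_le (hA : HasProfileHazard A M) {D : Fin n → ℕ}
    (Z : Adversary m D) {σ : Fin n → Equiv.Perm (Fin m)} (hσ : ¬ Collision σ D)
    (hM : DemandsLe A M Z σ) :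
    histExpect A D σ (fun τ => collisionRisk A Z τ + collisionProb A ⟨n, D⟩) ≤
      histExpect A D σ (fun τ => 2 * finalCollisionProb A Z τ) := by
  induction Z with
  | halt =>
    refine histExpect_mono fun τ hτ => ?_
    rw [collisionRisk, finalCollisionProb, play, expect_pure, expect_pure,
      collisionIndicator_of_not_collision (by rwa [collision_iff_of_mem_history hτ]), zero_add,
      two_mul]
    exact le_self_add
  | activate hm next ih => exact histExpect_activate_le hA hm next hσ hM fun x _ => ih x
  | request j hj next ih => exact histExpect_le_of_next hA hj rfl next hσ hM fun x _ => ih x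
  | toss μ next ih => exact histExpect_toss_le μ next hM fun r => ih r hσ

end Adversary

theorem HasProfileHazard.adaptiveCollisionProb_le {A : Algorithm m} {M : ℕ}
    (hA : HasProfileHazard A M) (Z : Adaptive m)
    (hM : ∀ o ∈ (game A Z).support, ∀ i, o.2.2 i ≤ M) :
    adaptiveCollisionProb A Z ≤ 2 * expect (game A Z) fun o => collisionProb A o.profile := by
  have hstart (f : (Fin 0 → Equiv.Perm (Fin m)) → ℝ≥0∞) : histExpect A ![] ![] f = f ![] := by
    rw [histExpect, sum_eq_single_of_mem _ (mem_history_iff_eq.2 rfl) fun τ _ hτ =>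
      absurd (Subsingleton.elim τ _) hτ]
    simp
  have hbound := Z.histExpect_collisionRisk_add_le hA (σ := ![]) (fun ⟨i, _⟩ => i.elim0)
    fun τ _ _ => Subsingleton.elim ![] τ ▸ hM
  rw [hstart, hstart] at hbound
  refine le_trans (le_of_eq ?_) (le_self_add.trans hbound)
  simp only [adaptiveCollisionProb, Adversary.collisionRisk, expect, game, collisionIndicator,
    mul_ite, mul_one, mul_zero]

/-! ### Algorithms with a profile hazard -/

/-- The first `d` IDs in the order `σ`. -/
def firstIDs (d : ℕ) (σ : Equiv.Perm (Fin m)) : Finset (Fin m) :=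
  image σ {a | (a : ℕ) < d}

/-- The IDs that instances other than `j` return. -/
def othersIDs (D : Fin n → ℕ) (σ : Fin n → Equiv.Perm (Fin m)) (j : Fin n) : Finset (Fin m) :=
  (univ.erase j).biUnion fun i => firstIDs (D i) (σ i)

section ReturnedIDs

theorem mem_firstIDs {d : ℕ} {σ : Equiv.Perm (Fin m)} {x : Fin m} :
    x ∈ firstIDs d σ ↔ ∃ a : Fin m, (a : ℕ) < d ∧ σ a = x := by
  simp [firstIDs]

theorem apply_notMem_firstIDs (σ : Equiv.Perm (Fin m)) (t : Fin m) : σ t ∉ firstIDs t σ := by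
  rw [mem_firstIDs]
  rintro ⟨a, ha, e⟩
  exact ha.ne (congrArg Fin.val (σ.injective e))

theorem firstIDs_eq_of_mem_cylinder {d : ℕ} {σ τ : Equiv.Perm (Fin m)} (h : τ ∈ cylinder d σ) :
    firstIDs d τ = firstIDs d σ :=
  image_congr fun a ha => mem_cylinder.1 h a (by simpa using ha)

theorem card_firstIDs_inter {d M : ℕ} {σ : Equiv.Perm (Fin m)} {G T : Finset (Fin m)}
    (hG : ∀ a : Fin m, (a : ℕ) < M → (σ a ∈ G ↔ a ∈ T)) (hd : d ≤ M) :
    #(firstIDs d σ ∩ G) = #{a ∈ T | a.val < d} := by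
  rw [← card_image_of_injective {a ∈ T | a.val < d} σ.injective]
  congr 1
  ext x
  simp only [mem_inter, mem_firstIDs, mem_image, mem_filter]
  constructor
  · rintro ⟨⟨a, ha, rfl⟩, hx⟩
    exact ⟨a, ⟨(hG a (ha.trans_le hd)).1 hx, ha⟩, rfl⟩
  · rintro ⟨a, ⟨haT, ha⟩, rfl⟩
    exact ⟨⟨a, ha, rfl⟩, (hG a (ha.trans_le hd)).2 haT⟩

variable {D : Fin n → ℕ} {σ τ : Fin n → Equiv.Perm (Fin m)} {j : Fin n}

theorem disjoint_firstIDs_of_not_collision (h : ¬ Collision σ D) {i : Fin n} (hij : i ≠ j) :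
    Disjoint (firstIDs (D i) (σ i)) (firstIDs (D j) (σ j)) := by
  simp only [disjoint_left, mem_firstIDs]
  rintro _ ⟨a, ha, rfl⟩ ⟨b, hb, e⟩
  exact h ⟨i, j, hij, a, b, ha, hb, e.symm⟩

theorem mem_othersIDs {x : Fin m} :
    x ∈ othersIDs D σ j ↔ ∃ i, i ≠ j ∧ ∃ a : Fin m, (a : ℕ) < D i ∧ σ i a = x := by
  simp [othersIDs, mem_firstIDs]

theorem othersIDs_eq_of_mem_history (h : τ ∈ history D σ) (j : Fin n) :
    othersIDs D τ j = othersIDs D σ j :=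
  biUnion_congr rfl fun i _ => firstIDs_eq_of_mem_cylinder (Fintype.mem_piFinset.1 h i)

theorem collision_update_iff (hj : D j < m) (hσ : ¬ Collision σ D) :
    Collision σ (Function.update D j (D j + 1)) ↔ σ j ⟨D j, hj⟩ ∈ othersIDs D σ j := by
  rw [mem_othersIDs]
  constructor
  · intro h
    have hnew {i k : Fin n} (hik : i ≠ k) {a b : Fin m}
        (ha : (a : ℕ) < Function.update D j (D j + 1) i)
        (hb : (b : ℕ) < Function.update D j (D j + 1) k) (e : σ i a = σ k b)
        (hai : ¬ (a : ℕ) < D i) :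
        ∃ i, i ≠ j ∧ ∃ a : Fin m, (a : ℕ) < D i ∧ σ i a = σ j ⟨D j, hj⟩ := by
      obtain rfl : i = j := by
        by_contra hij
        exact hai (by rwa [Function.update_of_ne hij] at ha)
      rw [Function.update_self] at ha
      rw [Function.update_of_ne hik.symm] at hb
      exact ⟨k, hik.symm, b, hb, by rw [← e]; congr 1; exact Fin.ext (by simp; omega)⟩
    obtain ⟨i, k, hik, a, b, ha, hb, e⟩ := h
    by_cases hai : (a : ℕ) < D i
    · refine hnew hik.symm hb ha e.symm fun hbk => ?_
      exact hσ ⟨i, k, hik, a, b, hai, hbk, e⟩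
    · exact hnew hik ha hb e hai
  · rintro ⟨i, hij, a, ha, e⟩
    exact ⟨i, j, hij, a, ⟨D j, hj⟩, by rwa [Function.update_of_ne hij], by simp, e⟩

theorem card_othersIDs_inter_sdiff {M : ℕ} {G T : Finset (Fin m)} (hσ : ¬ Collision σ D)
    (hG : ∀ i, ∀ a : Fin m, (a : ℕ) < M → (σ i a ∈ G ↔ a ∈ T)) (hD : ∀ i, D i ≤ M) :
    #(othersIDs D σ j ∩ (G \ firstIDs (D j) (σ j))) =
      ∑ i ∈ univ.erase j, #{a ∈ T | a.val < D i} := by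
  have hdisj : Disjoint (othersIDs D σ j) (firstIDs (D j) (σ j)) :=
    (disjoint_biUnion_left _ _ _).2 fun i hi =>
      disjoint_firstIDs_of_not_collision hσ (ne_of_mem_erase hi)
  rw [← inter_sdiff_assoc, sdiff_eq_self_of_disjoint (hdisj.mono_left inter_subset_left), othersIDs,
    biUnion_inter, card_biUnion fun i _ k _ hik =>
      (disjoint_firstIDs_of_not_collision hσ hik).mono inter_subset_left inter_subset_left]
  exact sum_congr rfl fun i _ => card_firstIDs_inter (hG i) (hD i)

end ReturnedIDs

/-- If an ID returned at time `t` collides with an ID that another instance returns before time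
`M`, then the two instances have collided already. -/
def IsForcedAt (A : Algorithm m) (M : ℕ) (t : Fin m) : Prop :=
  ∀ σ ∈ A.support, ∀ τ ∈ A.support, ∀ b : Fin m, (b : ℕ) < M → τ b = σ t →
    ∃ a < t, ∃ b' ≤ b, σ a = τ b'

/-- Given the previous IDs, the ID returned at time `t` is uniformly distributed among the unused
elements of `G`.  Up to time `M`, the times at which elements of `G` are returned are those
in `T`. -/
structure IsUniformAt (A : Algorithm m) (M : ℕ) (t : Fin m) (G T : Finset (Fin m)) : Prop where
  mem_times : t ∈ T
  apply_mem_iff : ∀ σ ∈ A.support, ∀ a : Fin m, (a : ℕ) < M → (σ a ∈ G ↔ a ∈ T)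
  measure_eq : ∀ σ, ∀ x ∈ G \ firstIDs t σ, ∀ y ∈ G \ firstIDs t σ,
    A.toOuterMeasure {τ | τ ∈ cylinder t σ ∧ τ t = x} =
      A.toOuterMeasure {τ | τ ∈ cylinder t σ ∧ τ t = y}

theorem IsUniformAt.sum_ite_mem_eq {A : Algorithm m} {M : ℕ} {t : Fin m} {G T : Finset (Fin m)}
    (hA : IsUniformAt A M t G T) (ht : (t : ℕ) < M) (σ : Equiv.Perm (Fin m))
    (Y : Finset (Fin m)) :
    ∑ τ ∈ cylinder t σ, A τ * (if τ t ∈ Y then 1 else 0) =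
      #(Y ∩ (G \ firstIDs t σ)) / #(G \ firstIDs t σ) * ∑ τ ∈ cylinder t σ, A τ := by
  set U := G \ firstIDs t σ
  have hU : ∀ τ ∈ cylinder t σ, A τ ≠ 0 → τ t ∈ U := fun τ hτ hA0 => mem_sdiff.2
    ⟨(hA.apply_mem_iff τ ((A.mem_support_iff τ).2 hA0) t ht).2 hA.mem_times,
      firstIDs_eq_of_mem_cylinder hτ ▸ apply_notMem_firstIDs τ t⟩
  obtain ⟨u, hu⟩ : ∃ u, ∀ x ∈ U, ∑ τ ∈ cylinder t σ with τ t = x, A τ = u := by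
    obtain hUe | ⟨y, hy⟩ := U.eq_empty_or_nonempty
    · exact ⟨0, by simp [hUe]⟩
    refine ⟨∑ τ ∈ cylinder t σ with τ t = y, A τ, fun x hx => ?_⟩
    rw [← PMF.toOuterMeasure_apply_finset, ← PMF.toOuterMeasure_apply_finset, coe_filter,
      coe_filter]
    exact hA.measure_eq σ x hx y hy
  have hmass (Y : Finset (Fin m)) :
      ∑ τ ∈ cylinder t σ, A τ * (if τ t ∈ Y then 1 else 0) = #(Y ∩ U) * u := by
    rw [← nsmul_eq_mul, ← sum_const, ← sum_congr rfl fun x hx => hu x (mem_inter.1 hx).2,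
      sum_fiberwise_eq_sum_filter, sum_filter]
    refine sum_congr rfl fun τ hτ => ?_
    by_cases hA0 : A τ = 0
    · simp [hA0]
    · simp [hU τ hτ hA0]
  have htotal : ∑ τ ∈ cylinder t σ, A τ = #U * u := by
    simpa using hmass univ
  rw [hmass, htotal]
  obtain hUe | hUne := U.eq_empty_or_nonempty
  · simp [hUe]
  · rw [← mul_assoc, ENNReal.div_mul_cancel (by simpa using hUne.ne_empty)
      (ENNReal.natCast_ne_top _)]

theorem histExpect_apply_eq_mul {A : Algorithm m} {D : Fin n → ℕ}
    {σ : Fin n → Equiv.Perm (Fin m)} {j : Fin n} {g : Equiv.Perm (Fin m) → ℝ≥0∞} {c : ℝ≥0∞}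
    (h : ∑ υ ∈ cylinder (D j) (σ j), A υ * g υ = c * ∑ υ ∈ cylinder (D j) (σ j), A υ) :
    histExpect A D σ (fun τ => g (τ j)) = c * histExpect A D σ 1 := by
  have hprod (f : Equiv.Perm (Fin m) → ℝ≥0∞) : histExpect A D σ (fun τ => f (τ j)) =
      (∑ υ ∈ cylinder (D j) (σ j), A υ * f υ) *
        ∏ i ∈ univ.erase j, ∑ υ ∈ cylinder (D i) (σ i), A υ := by
    calc histExpect A D σ (fun τ => f (τ j))
      _ = ∑ τ ∈ history D σ, ∏ i, A (τ i) * (if i = j then f (τ i) else 1) := by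
          simp only [histExpect, prod_mul_distrib, prod_ite_eq', mem_univ, if_true]
      _ = ∏ i, ∑ υ ∈ cylinder (D i) (σ i), A υ * (if i = j then f υ else 1) :=
          by rw [prod_univ_sum, history]
      _ = _ := by
          rw [← mul_prod_erase _ _ (mem_univ j)]
          simp only [if_true]
          congr 1
          exact prod_congr rfl fun i hi => by simp only [if_neg (ne_of_mem_erase hi), mul_one]
  have hone := hprod 1
  simp only [Pi.one_apply, mul_one] at hone
  rw [hprod, h, mul_assoc, ← hone]
  rfl

theorem isHazard_of_forall_mem_support {A : Algorithm m} {D D' : Fin n → ℕ} {h : ℝ≥0∞}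
    (hh : ∀ σ : Fin n → Equiv.Perm (Fin m), (∀ i, σ i ∈ A.support) → ¬ Collision σ D →
      histExpect A D σ (collisionIndicator D') = h * histExpect A D σ 1) : IsHazard A D D' h := by
  intro σ hσ
  by_cases hsupp : ∃ τ ∈ history D σ, ∀ i, τ i ∈ A.support
  · obtain ⟨τ, hτ, hs⟩ := hsupp
    have hτσ := hh τ hs (by rwa [collision_iff_of_mem_history hτ])
    rwa [histExpect, histExpect, mem_history_iff_eq.1 hτ] at hτσ
  · push Not at hsupp
    have hzero (f) : histExpect A D σ f = 0 :=
      histExpect_eq_zero fun τ hτ hs => absurd hs (by simpa using hsupp τ hτ)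
    rw [hzero, hzero, mul_zero]

theorem IsForcedAt.isHazard {A : Algorithm m} {M : ℕ} {D : Fin n → ℕ} {j : Fin n} (hj : D j < m)
    (hA : IsForcedAt A M ⟨D j, hj⟩) (hD : ∀ i, D i ≤ M) :
    IsHazard A D (Function.update D j (D j + 1)) 0 := by
  intro σ hσ
  rw [zero_mul]
  refine histExpect_eq_zero fun τ hτ hs => collisionIndicator_of_not_collision fun hc => ?_
  rw [← collision_iff_of_mem_history hτ] at hσ
  rw [collision_update_iff hj hσ, mem_othersIDs] at hc
  obtain ⟨i, hij, b, hb, e⟩ := hc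
  obtain ⟨a, ha, b', hb', e'⟩ := hA (τ j) (hs j) (τ i) (hs i) b (hb.trans_le (hD i)) e
  exact hσ ⟨j, i, hij.symm, a, b', ha, (Fin.le_def.1 hb').trans_lt hb, e'⟩

theorem IsUniformAt.isHazard {A : Algorithm m} {M : ℕ} {D : Fin n → ℕ} {j : Fin n} (hj : D j < m)
    {G T : Finset (Fin m)} (hA : IsUniformAt A M ⟨D j, hj⟩ G T) (hD : ∀ i, D i ≤ M)
    (hjM : D j < M) :
    IsHazard A D (Function.update D j (D j + 1))
      ((∑ i ∈ univ.erase j, #{a ∈ T | a.val < D i} : ℕ) /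
        (#G - #{a ∈ T | a.val < D j} : ℕ)) := by
  refine isHazard_of_forall_mem_support fun σ hs hσ => ?_
  have hG i := hA.apply_mem_iff (σ i) (hs i)
  rw [← card_othersIDs_inter_sdiff hσ hG hD, ← card_firstIDs_inter (hG j) (hD j), ← card_sdiff]
  refine Eq.trans (histExpect_congr fun τ hτ => ?_)
    (histExpect_apply_eq_mul (hA.sum_ite_mem_eq hjM (σ j) (othersIDs D σ j)))
  rw [← othersIDs_eq_of_mem_history hτ]
  rw [← collision_iff_of_mem_history hτ] at hσ
  rw [collisionIndicator, collision_update_iff hj hσ]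
  congr

theorem hasProfileHazard_of_forall_isForcedAt_or_isUniformAt {A : Algorithm m} {M : ℕ}
    (hA : ∀ t : Fin m, (t : ℕ) < M → IsForcedAt A M t ∨ ∃ G T, IsUniformAt A M t G T) :
    HasProfileHazard A M := by
  intro n D j hj hD
  have hDM i : D i ≤ M := (le_update_succ D j i).trans (hD i)
  have hjM : D j < M := by simpa using hD j
  obtain hforced | ⟨G, T, huniform⟩ := hA ⟨D j, hj⟩ hjM
  · exact ⟨0, hforced.isHazard hj hDM⟩
  · exact ⟨_, huniform.isHazard hj hDM hjM⟩

theorem uniformOfFintype_toOuterMeasure_le {α : Type*} [Fintype α] [Nonempty α] {s t : Set α}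
    (g : α → α) (hg : Set.MapsTo g s t) (hinj : Set.InjOn g s) :
    (PMF.uniformOfFintype α).toOuterMeasure s ≤ (PMF.uniformOfFintype α).toOuterMeasure t := by
  classical
  rw [PMF.toOuterMeasure_uniformOfFintype_apply, PMF.toOuterMeasure_uniformOfFintype_apply]
  gcongr
  exact Fintype.card_le_of_injective _ (hg.restrict_inj.2 hinj)

/-! ### `BINS(k)` -/

section Bins

/-- The first element of the bin of `a`. -/
def binStart (k : ℕ) (a : Fin m) : Fin m :=
  ⟨a / k * k, (Nat.div_mul_le_self _ _).trans_lt a.isLt⟩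

/-- The first elements of the `m / k` bins, without that of the leftover part. -/
def binStarts (m k : ℕ) : Finset (Fin m) :=
  {a | (a : ℕ) % k = 0 ∧ (a : ℕ) / k < m / k}

variable {k : ℕ} (π π' : Equiv.Perm (Fin (m / k))) {a b t x y : Fin m}

theorem mem_binStarts : a ∈ binStarts m k ↔ (a : ℕ) % k = 0 ∧ (a : ℕ) / k < m / k := by
  simp [binStarts]

theorem binStart_le (k : ℕ) (a : Fin m) : binStart k a ≤ a := Nat.div_mul_le_self _ _

theorem binStart_div (hk : 0 < k) (a : Fin m) : (binStart k a : ℕ) / k = (a : ℕ) / k :=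
  Nat.mul_div_cancel _ hk

theorem binStart_eq_iff (hk : 0 < k) (hx : (x : ℕ) % k = 0) :
    binStart k a = x ↔ (a : ℕ) / k = (x : ℕ) / k := by
  rw [Fin.ext_iff, binStart]
  constructor
  · intro h
    rw [← h, Nat.mul_div_cancel _ hk]
  · intro h
    simp only [h, Nat.div_mul_cancel (Nat.dvd_of_mod_eq_zero hx)]

theorem binsPerm_apply (h : (a : ℕ) / k < m / k) :
    (binsPerm m k π a : ℕ) = π ⟨a / k, h⟩ * k + a % k := by
  simp [binsPerm, binsFun, h]

theorem binsPerm_leftover (h : ¬ (a : ℕ) / k < m / k) : binsPerm m k π a = a := by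
  ext
  simp [binsPerm, binsFun, h]

variable {π π'} in
theorem binsPerm_congr (h : (a : ℕ) / k < m / k) (e : π ⟨a / k, h⟩ = π' ⟨a / k, h⟩) :
    binsPerm m k π a = binsPerm m k π' a :=
  Fin.ext (by rw [binsPerm_apply π h, binsPerm_apply π' h, e])

theorem binsPerm_div (hk : 0 < k) (h : (a : ℕ) / k < m / k) :
    (binsPerm m k π a : ℕ) / k = π ⟨a / k, h⟩ := by
  rw [binsPerm_apply π h, Nat.add_comm, Nat.add_mul_div_right _ _ hk,
    Nat.div_eq_of_lt (Nat.mod_lt _ hk), Nat.zero_add]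

theorem binsPerm_mod : (binsPerm m k π a : ℕ) % k = (a : ℕ) % k := by
  by_cases h : (a : ℕ) / k < m / k
  · rw [binsPerm_apply π h, Nat.add_comm, Nat.add_mul_mod_self_right, Nat.mod_mod]
  · rw [binsPerm_leftover π h]

theorem binsPerm_div_lt_iff (hk : 0 < k) :
    (binsPerm m k π a : ℕ) / k < m / k ↔ (a : ℕ) / k < m / k := by
  by_cases h : (a : ℕ) / k < m / k
  · simp only [binsPerm_div π hk h, Fin.is_lt, h]
  · rw [binsPerm_leftover π h]

theorem binsPerm_mem_binStarts_iff (hk : 0 < k) :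
    binsPerm m k π a ∈ binStarts m k ↔ a ∈ binStarts m k := by
  rw [mem_binStarts, mem_binStarts, binsPerm_mod, binsPerm_div_lt_iff π hk]

theorem binsPerm_binStart (hk : 0 < k) (a : Fin m) :
    binsPerm m k π (binStart k a) = binStart k (binsPerm m k π a) := by
  by_cases h : (a : ℕ) / k < m / k
  · have hs : (binStart k a : ℕ) / k < m / k := by rwa [binStart_div hk]
    symm
    rw [binStart_eq_iff hk (by rw [binsPerm_mod]; exact Nat.mul_mod_left _ _), binsPerm_div π hk h,
      binsPerm_div π hk hs]
    simp only [binStart_div hk]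
  · rw [binsPerm_leftover π h, binsPerm_leftover π (by rwa [binStart_div hk])]

theorem mem_support_bins {σ : Equiv.Perm (Fin m)} :
    σ ∈ (bins m k).support ↔ ∃ π, binsPerm m k π = σ := by
  simp [bins]

theorem binsPerm_symm_apply_zero_lt (hk : 0 < k) (hkm : k ≤ m) (ht : ¬ (t : ℕ) / k < m / k) :
    (binsPerm m k π).symm (binsPerm m k π' ⟨0, hk.trans_le hkm⟩) < t := by
  set a := (binsPerm m k π).symm (binsPerm m k π' ⟨0, hk.trans_le hkm⟩)
  have ha : (a : ℕ) / k < m / k := by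
    rw [← binsPerm_div_lt_iff π hk, Equiv.apply_symm_apply, binsPerm_div_lt_iff π' hk, Nat.zero_div]
    exact Nat.div_pos hkm hk
  exact not_le.1 fun hta => ht ((Nat.div_le_div_right hta).trans_lt ha)

theorem isForcedAt_bins (hk : 0 < k) (hkm : k ≤ m) (M : ℕ) (ht : t ∉ binStarts m k) :
    IsForcedAt (bins m k) M t := by
  intro σ hσ τ hτ b _ e
  obtain ⟨π, rfl⟩ := mem_support_bins.1 hσ
  obtain ⟨π', rfl⟩ := mem_support_bins.1 hτ
  by_cases h : (t : ℕ) / k < m / k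
  · refine ⟨binStart k t, lt_of_le_of_ne (binStart_le k t) fun hst => ht ?_, binStart k b,
      binStart_le k b, by rw [binsPerm_binStart π hk, binsPerm_binStart π' hk, e]⟩
    exact mem_binStarts.2 ⟨by rw [← hst]; exact Nat.mul_mod_left _ _, h⟩
  · exact ⟨_, binsPerm_symm_apply_zero_lt π π' hk hkm h, _, Nat.zero_le _,
      Equiv.apply_symm_apply _ _⟩

theorem bins_toOuterMeasure_le (hk : 0 < k) (ht : t ∈ binStarts m k) {σ : Equiv.Perm (Fin m)}
    (hx : x ∈ binStarts m k) (hy : y ∈ binStarts m k \ firstIDs t σ) :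
    (bins m k).toOuterMeasure {τ | τ ∈ cylinder t σ ∧ τ t = x} ≤
      (bins m k).toOuterMeasure {τ | τ ∈ cylinder t σ ∧ τ t = y} := by
  obtain ⟨ht0, htk⟩ := mem_binStarts.1 ht
  obtain ⟨-, hxk⟩ := mem_binStarts.1 hx
  obtain ⟨hyG, hyσ⟩ := mem_sdiff.1 hy
  obtain ⟨hy0, hyk⟩ := mem_binStarts.1 hyG
  rw [bins, PMF.toOuterMeasure_map_apply, PMF.toOuterMeasure_map_apply]
  refine uniformOfFintype_toOuterMeasure_le
    (fun π => Equiv.swap ⟨x / k, hxk⟩ ⟨y / k, hyk⟩ * π) ?_ (mul_right_injective _).injOn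
  rintro π ⟨hπ, hπx⟩
  rw [mem_cylinder] at hπ
  have hπt : π ⟨t / k, htk⟩ = ⟨x / k, hxk⟩ := Fin.ext (by rw [← binsPerm_div π hk htk, hπx])
  refine ⟨mem_cylinder.2 fun a ha => ?_, ?_⟩
  · rw [← hπ a ha]
    have hat : (a : ℕ) / k < (t : ℕ) / k := by
      rwa [Nat.div_lt_iff_lt_mul hk, Nat.div_mul_cancel (Nat.dvd_of_mod_eq_zero ht0)]
    refine binsPerm_congr (hat.trans htk) (Equiv.swap_apply_of_ne_of_ne ?_ fun hay => hyσ ?_)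
    · rw [← hπt]
      exact fun h => hat.ne (congrArg Fin.val (π.injective h))
    · refine mem_firstIDs.2 ⟨binStart k a, (binStart_le k a).trans_lt ha, ?_⟩
      rw [← hπ _ ((binStart_le k a).trans_lt ha), binsPerm_binStart π hk, binStart_eq_iff hk hy0,
        binsPerm_div π hk (hat.trans htk), hay]
  · ext
    simp only [binsPerm_apply _ htk, Equiv.Perm.mul_apply, hπt, Equiv.swap_apply_left, ht0,
      Nat.add_zero, Nat.div_mul_cancel (Nat.dvd_of_mod_eq_zero hy0)]

theorem isUniformAt_bins (hk : 0 < k) (M : ℕ) (ht : t ∈ binStarts m k) :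
    IsUniformAt (bins m k) M t (binStarts m k) (binStarts m k) where
  mem_times := ht
  apply_mem_iff σ hσ a _ := by
    obtain ⟨π, rfl⟩ := mem_support_bins.1 hσ
    exact binsPerm_mem_binStarts_iff π hk
  measure_eq σ x hx y hy := le_antisymm
    (bins_toOuterMeasure_le hk ht (mem_sdiff.1 hx).1 hy)
    (bins_toOuterMeasure_le hk ht (mem_sdiff.1 hy).1 hx)

theorem hasProfileHazard_bins (hk : 0 < k) (hkm : k ≤ m) (M : ℕ) :
    HasProfileHazard (bins m k) M :=
  hasProfileHazard_of_forall_isForcedAt_or_isUniformAt fun t _ =>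
    if ht : t ∈ binStarts m k then .inr ⟨_, _, isUniformAt_bins hk M ht⟩
    else .inl (isForcedAt_bins hk hkm M ht)

end Bins

/-! ### `BINS*` -/

section BinsStar

/-- The time at which `BINS*` returns the `j`-th ID of its bin of chunk `i`. -/
def binTime (i : Fin (chunks m)) (j : Fin (2 ^ (i : ℕ))) : Fin m :=
  ⟨2 ^ (i : ℕ) - 1 + j, time_lt i j⟩

/-- The `j`-th ID of bin `b` of chunk `i` in a division into `C` chunks. -/
def binID (C i b j : ℕ) : ℕ := i * 2 ^ (C - 1) + b * 2 ^ i + j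

/-- The IDs with which the bins of chunk `i` start. -/
noncomputable def chunkBinStarts (i : Fin (chunks m)) : Finset (Fin m) :=
  {x | ∃ r : Fin (2 ^ (chunks m - 1 - (i : ℕ))), binID (chunks m) i r 0 = x}

variable {A : Algorithm m} {i i' : Fin (chunks m)} {x y : Fin m}

theorem mem_chunkBinStarts :
    x ∈ chunkBinStarts i ↔
      ∃ r : Fin (2 ^ (chunks m - 1 - (i : ℕ))), binID (chunks m) i r 0 = x := by
  simp [chunkBinStarts]

theorem binTime_add_one (i : Fin (chunks m)) (j : Fin (2 ^ (i : ℕ))) :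
    (binTime i j : ℕ) + 1 = 2 ^ (i : ℕ) + j := by
  have := Nat.two_pow_pos (i : ℕ)
  simp only [binTime]
  omega

theorem binTime_zero_add_one (i : Fin (chunks m)) : (binTime i 0 : ℕ) + 1 = 2 ^ (i : ℕ) := by
  rw [binTime_add_one, Fin.val_zero, Nat.add_zero]

theorem log_binTime_add_one (i : Fin (chunks m)) (j : Fin (2 ^ (i : ℕ))) :
    Nat.log 2 (binTime i j + 1) = i := by
  rw [binTime_add_one]
  exact Nat.log_eq_of_pow_le_of_lt_pow (Nat.le_add_right _ _) (by rw [pow_succ]; omega)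

theorem exists_binTime_eq {a : Fin m} (ha : (a : ℕ) < 2 ^ chunks m - 1) :
    ∃ (i : Fin (chunks m)) (j : Fin (2 ^ (i : ℕ))), binTime i j = a := by
  have hle : 2 ^ Nat.log 2 (a + 1) ≤ (a : ℕ) + 1 := Nat.pow_log_le_self 2 (by omega)
  have hlt : (a : ℕ) + 1 < 2 ^ (Nat.log 2 (a + 1) + 1) :=
    Nat.lt_pow_succ_log_self Nat.one_lt_two _
  have hlog : Nat.log 2 (a + 1) < chunks m := Nat.log_lt_of_lt_pow (by omega) (by omega)
  rw [pow_succ] at hlt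
  refine ⟨⟨_, hlog⟩, ⟨a + 1 - 2 ^ Nat.log 2 (a + 1), by simp only; omega⟩, Fin.ext ?_⟩
  apply Nat.succ_injective
  rw [Nat.succ_eq_add_one, binTime_add_one]
  exact Nat.add_sub_of_le hle

theorem binTime_lt_binTime_zero_iff {j' : Fin (2 ^ (i' : ℕ))} :
    binTime i' j' < binTime i 0 ↔ i' < i := by
  calc binTime i' j' < binTime i 0
    _ ↔ (binTime i' j' : ℕ) + 1 < 2 ^ (i : ℕ) := by
        have := binTime_zero_add_one i
        rw [Fin.lt_def]
        omega
    _ ↔ Nat.log 2 (binTime i' j' + 1) < i :=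
        (Nat.log_lt_iff_lt_pow Nat.one_lt_two (Nat.succ_ne_zero _)).symm
    _ ↔ i' < i := by rw [log_binTime_add_one, Fin.lt_def]

theorem mul_pow_add_lt {C i b j : ℕ} (hi : i < C) (hb : b < 2 ^ (C - 1 - i)) (hj : j < 2 ^ i) :
    b * 2 ^ i + j < 2 ^ (C - 1) := by
  calc b * 2 ^ i + j < (b + 1) * 2 ^ i := by rw [Nat.add_one_mul]; gcongr
    _ ≤ 2 ^ (C - 1 - i) * 2 ^ i := by gcongr; exact hb
    _ = 2 ^ (C - 1) := by rw [← pow_add, Nat.sub_add_cancel (by omega)]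

theorem eq_and_eq_of_mul_add_eq {d q q' r r' : ℕ} (hr : r < d) (hr' : r' < d)
    (h : q * d + r = q' * d + r') : q = q' ∧ r = r' := by
  have hd : 0 < d := by omega
  refine ⟨?_, ?_⟩
  · simpa [Nat.mul_add_div, mul_comm _ d, hd, Nat.div_eq_of_lt, hr, hr'] using congrArg (· / d) h
  · simpa [Nat.mul_add_mod', Nat.mod_eq_of_lt, hr, hr'] using congrArg (· % d) h

theorem eq_and_eq_and_eq_of_binID_eq {C i i' b b' j j' : ℕ} (hi : i < C)
    (hb : b < 2 ^ (C - 1 - i)) (hj : j < 2 ^ i) (hi' : i' < C) (hb' : b' < 2 ^ (C - 1 - i'))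
    (hj' : j' < 2 ^ i') (h : binID C i b j = binID C i' b' j') : i = i' ∧ b = b' ∧ j = j' := by
  rw [binID, binID, Nat.add_assoc, Nat.add_assoc] at h
  obtain ⟨rfl, h⟩ := eq_and_eq_of_mul_add_eq (mul_pow_add_lt hi hb hj)
    (mul_pow_add_lt hi' hb' hj') h
  exact ⟨rfl, eq_and_eq_of_mul_add_eq hj hj' h⟩

namespace IsBinsStar

theorem exists_bins (hA : IsBinsStar A) {σ : Equiv.Perm (Fin m)} (hσ : σ ∈ A.support) :
    ∃ b : (i : Fin (chunks m)) → Fin (2 ^ (chunks m - 1 - (i : ℕ))),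
      ∀ i j, (σ (binTime i j) : ℕ) = binID (chunks m) i (b i) j := by
  have hmem := (PMF.mem_support_map_iff (fun (σ : Equiv.Perm (Fin m)) (i : Fin (chunks m))
    (j : Fin (2 ^ (i : ℕ))) => (σ ⟨2 ^ (i : ℕ) - 1 + j, time_lt i j⟩ : ℕ)) A _).2 ⟨σ, hσ, rfl⟩
  rw [hA, PMF.mem_support_map_iff] at hmem
  obtain ⟨b, -, hb⟩ := hmem
  exact ⟨b, fun i j => (congrFun₂ hb i j).symm⟩

theorem isForcedAt (hA : IsBinsStar A) {j : Fin (2 ^ (i : ℕ))} (hj : j ≠ 0) :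
    IsForcedAt A (2 ^ chunks m - 1) (binTime i j) := by
  intro σ hσ τ hτ b hb e
  obtain ⟨β, hβ⟩ := hA.exists_bins hσ
  obtain ⟨γ, hγ⟩ := hA.exists_bins hτ
  obtain ⟨i', j', rfl⟩ := exists_binTime_eq hb
  have hID := congrArg Fin.val e
  rw [hβ, hγ] at hID
  obtain ⟨hi, hbin, -⟩ := eq_and_eq_and_eq_of_binID_eq i'.isLt (γ i').isLt j'.isLt i.isLt
    (β i).isLt j.isLt hID
  obtain rfl : i' = i := Fin.ext hi
  have hle (j : Fin (2 ^ (i' : ℕ))) : binTime i' 0 ≤ binTime i' j := by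
    exact Nat.add_le_add_left (Nat.zero_le j) _
  refine ⟨binTime i' 0, (hle j).lt_of_ne fun h0 => hj ?_, binTime i' 0, hle j', Fin.ext ?_⟩
  · exact Fin.ext (Nat.add_left_cancel (congrArg Fin.val h0)).symm
  · rw [hβ, hγ, hbin]

theorem apply_mem_chunkBinStarts_iff (hA : IsBinsStar A) {σ : Equiv.Perm (Fin m)}
    (hσ : σ ∈ A.support) {a : Fin m} (ha : (a : ℕ) < 2 ^ chunks m - 1) :
    σ a ∈ chunkBinStarts i ↔ a = binTime i 0 := by
  obtain ⟨b, hb⟩ := hA.exists_bins hσ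
  obtain ⟨i', j', rfl⟩ := exists_binTime_eq ha
  rw [mem_chunkBinStarts]
  constructor
  · rintro ⟨r, hr⟩
    rw [hb] at hr
    obtain ⟨hi, -, hj⟩ := eq_and_eq_and_eq_of_binID_eq i.isLt r.isLt (Nat.two_pow_pos _) i'.isLt
      (b i').isLt j'.isLt hr
    obtain rfl : i = i' := Fin.ext hi
    rw [show j' = 0 from Fin.ext hj.symm]
  · intro h
    exact ⟨b i, by rw [h, hb]; rfl⟩

theorem toOuterMeasure_preimage (hA : IsBinsStar A)
    (S : Set ((i : Fin (chunks m)) → Fin (2 ^ (i : ℕ)) → ℕ)) :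
    A.toOuterMeasure {τ | (fun i j => (τ (binTime i j) : ℕ)) ∈ S} =
      (PMF.uniformOfFintype
        ((i : Fin (chunks m)) → Fin (2 ^ (chunks m - 1 - (i : ℕ))))).toOuterMeasure {b |
          (fun (i : Fin (chunks m)) (j : Fin (2 ^ (i : ℕ))) =>
            binID (chunks m) i (b i) j) ∈ S} := by
  have hmap := congrArg (fun μ => μ.toOuterMeasure S) hA
  rwa [PMF.toOuterMeasure_map_apply, PMF.toOuterMeasure_map_apply] at hmap

theorem mem_cylinder_binTime_zero_iff {σ τ : Equiv.Perm (Fin m)} :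
    τ ∈ cylinder (binTime i 0) σ ↔
      ∀ i' < i, ∀ j', τ (binTime i' j') = σ (binTime i' j') := by
  rw [mem_cylinder]
  constructor
  · intro h i' hi' j'
    exact h _ (binTime_lt_binTime_zero_iff.2 hi')
  · intro h a ha
    have hlt : (a : ℕ) < 2 ^ chunks m - 1 := by
      have hi := binTime_zero_add_one i
      have := Nat.pow_lt_pow_right Nat.one_lt_two i.isLt
      omega
    obtain ⟨i', j', rfl⟩ := exists_binTime_eq hlt
    exact h i' (binTime_lt_binTime_zero_iff.1 ha) j'

theorem toOuterMeasure_le (hA : IsBinsStar A) (σ : Equiv.Perm (Fin m))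
    (hx : x ∈ chunkBinStarts i) (hy : y ∈ chunkBinStarts i) :
    A.toOuterMeasure {τ | τ ∈ cylinder (binTime i 0) σ ∧ τ (binTime i 0) = x} ≤
      A.toOuterMeasure {τ | τ ∈ cylinder (binTime i 0) σ ∧ τ (binTime i 0) = y} := by
  obtain ⟨r, hr⟩ := mem_chunkBinStarts.1 hx
  obtain ⟨s, hs⟩ := mem_chunkBinStarts.1 hy
  have hpre (z : Fin m) := hA.toOuterMeasure_preimage
    {f | (∀ i' < i, ∀ j', f i' j' = σ (binTime i' j')) ∧ f i 0 = z}
  simp only [Set.mem_ofPred_eq, ← Fin.ext_iff, ← mem_cylinder_binTime_zero_iff] at hpre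
  rw [hpre, hpre]
  refine uniformOfFintype_toOuterMeasure_le (fun b => Function.update b i s) ?_ ?_
  · rintro b ⟨hb, -⟩
    refine ⟨fun i' hi' j' => ?_, ?_⟩
    · simp only [Function.update_of_ne hi'.ne]
      exact hb i' hi' j'
    · simp only [Function.update_self]
      exact hs
  · have hbin : ∀ b : (i : Fin (chunks m)) → Fin (2 ^ (chunks m - 1 - (i : ℕ))),
        binID (chunks m) i (b i) 0 = x → b i = r := fun b hb => Fin.ext
      (eq_and_eq_and_eq_of_binID_eq i.isLt (b i).isLt (Nat.two_pow_pos _) i.isLt r.isLt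
        (Nat.two_pow_pos _) (hb.trans hr.symm)).2.1
    rintro b ⟨-, hb⟩ b' ⟨-, hb'⟩ e
    rw [← Function.update_eq_self i b, ← Function.update_eq_self i b', hbin b hb, hbin b' hb',
      ← Function.update_idem (a := i) s r b, ← Function.update_idem (a := i) s r b']
    exact congrArg (Function.update · i r) e

theorem isUniformAt (hA : IsBinsStar A) (i : Fin (chunks m)) :
    IsUniformAt A (2 ^ chunks m - 1) (binTime i 0) (chunkBinStarts i) {binTime i 0} where
  mem_times := mem_singleton_self _
  apply_mem_iff σ hσ a ha := by rw [hA.apply_mem_chunkBinStarts_iff hσ ha, mem_singleton]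
  measure_eq σ x hx y hy := le_antisymm
    (hA.toOuterMeasure_le σ (mem_sdiff.1 hx).1 (mem_sdiff.1 hy).1)
    (hA.toOuterMeasure_le σ (mem_sdiff.1 hy).1 (mem_sdiff.1 hx).1)

theorem hasProfileHazard (hA : IsBinsStar A) : HasProfileHazard A (2 ^ chunks m - 1) := by
  refine hasProfileHazard_of_forall_isForcedAt_or_isUniformAt fun t ht => ?_
  obtain ⟨i, j, rfl⟩ := exists_binTime_eq ht
  obtain rfl | hj := eq_or_ne j 0
  · exact .inr ⟨_, _, hA.isUniformAt i⟩
  · exact .inl (hA.isForcedAt hj)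

end IsBinsStar

end BinsStar

/-! ### Competitive ratios -/

theorem collisionProb_le_competitiveRatio_mul {A : Algorithm m} {𝒟 : Set Profile} {D : Profile}
    (hD : D ∈ 𝒟) (htop : competitiveRatio A 𝒟 ≠ ⊤) :
    collisionProb A D ≤ competitiveRatio A 𝒟 * optProb m D := by
  have hle : collisionProb A D / optProb m D ≤ competitiveRatio A 𝒟 :=
    le_iSup₂ (f := fun D (_ : D ∈ 𝒟) => collisionProb A D / optProb m D) D hD
  have hopt : optProb m D ≠ ⊤ := ne_top_of_le_ne_top ENNReal.one_ne_top
    ((iInf_le _ A).trans (collisionProb_le_one A D))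
  exact (ENNReal.div_le_iff_le_mul (.inr htop) (.inl hopt)).1 hle

theorem mainTheorem10_general {A : Algorithm m} {M : ℕ} (hA : HasProfileHazard A M)
    {𝒟 : Set Profile} (h𝒟 : ∀ D ∈ 𝒟, D.Nontrivial M) :
    adaptiveCompetitiveRatio A 𝒟 ≤ 2 * competitiveRatio A 𝒟 := by
  by_cases htop : competitiveRatio A 𝒟 = ⊤
  · rw [htop, ENNReal.mul_top two_ne_zero]
    exact le_top
  refine iSup₂_le fun Z hZ => ENNReal.div_le_of_le_mul ?_
  calc adaptiveCollisionProb A Z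
    _ ≤ 2 * expect (game A Z) fun o => collisionProb A o.profile :=
        hA.adaptiveCollisionProb_le Z fun o ho i => ((h𝒟 _ (hZ o ho)).2 i).2
    _ ≤ 2 * expect (game A Z) fun o => competitiveRatio A 𝒟 * optProb m o.profile := by
        gcongr
        exact expect_mono _ fun o ho => collisionProb_le_competitiveRatio_mul (hZ o ho) htop
    _ = 2 * competitiveRatio A 𝒟 * expectedOptProb A Z := by
        rw [expect_const_mul, mul_assoc]
        rfl

end UUID

open UUID in
/-- Let `A` be `BINS(k)` for some `k ∈ {1, …, m}`, or `BINS*`; in the latter case the profiles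
request no more IDs from an instance than `BINS*` specifies, which are `2 ^ C - 1`. -/
theorem mainTheorem10 (m : ℕ) (A : Algorithm m) (𝒟 : Set Profile)
    (h𝒟 : ∀ D ∈ 𝒟, D.Nontrivial m)
    (hA : (∃ k : ℕ, 1 ≤ k ∧ k ≤ m ∧ A = bins m k) ∨
      (IsBinsStar A ∧ ∀ D ∈ 𝒟, ∀ i, D.2 i ≤ 2 ^ chunks m - 1))
    (c : ENNReal) (hc : competitiveRatio A 𝒟 = c) :
    adaptiveCompetitiveRatio A 𝒟 ≤ 4 * c := by
  obtain ⟨M, hA, h𝒟⟩ : ∃ M, HasProfileHazard A M ∧ ∀ D ∈ 𝒟, D.Nontrivial M := by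
    obtain ⟨k, hk, hkm, rfl⟩ | ⟨hA, hM⟩ := hA
    · exact ⟨m, hasProfileHazard_bins hk hkm m, h𝒟⟩
    · exact ⟨_, hA.hasProfileHazard, fun D hD =>
        ⟨(h𝒟 D hD).1, fun i => ⟨((h𝒟 D hD).2 i).1, hM D hD i⟩⟩⟩
  calc adaptiveCompetitiveRatio A 𝒟 ≤ 2 * c := hc ▸ mainTheorem10_general hA h𝒟
    _ ≤ 4 * c := by gcongr; norm_num
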